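/- All systems $A,B,C,\dots$ are finite-dimensional quantum systems, $|C|=\dim\mathcal H_C$, and $C',C''$ denote copies of $C$. A quantum channel is a linear, completely positive, trace-preserving map. A bipartite state $\rho_{AB}$ is called separable if it is a finite convex combination of product states. It is called distillable if for every $\varepsilon>0$ there are $n\in\mathbb N$ and a (deterministic, finite-round) LOCC map $L$ from $A^nB^n$ to a pair of qubits, one on Alice's and one on Bob's side, with $$\mathrm{tr}\left[\Phi^+_{2}\,L(\rho_{AB}^{\otimes n})\right]\ge 1-\varepsilon ,$$ where $\Phi^+_2$ is the maximally entangled two-qubit state. It is called bound entangled if it is neither separable nor distillable. A $|C|$-dimensional teleportation protocol $(\rho_{AB},\{\Pi^i\}_{i=1}^N,\{\mathcal D^i\}_{i=1}^N)$ consists of a state $\rho_{AB}$, a POVM $\{\Pi^i_{C'A}\}_{i=1}^N$ on $C'A$, and quantum channels $\mathcal D^i\colon B\to C$. It implements the teleportation channel $\Lambda\colon C'\to C$, $$\Lambda(\sigma_{C'})=\sum_{i=1}^N(\mathrm{tr}_{C'A}\otimes\mathcal D^i)\left[(\Pi^i_{C'A}\otimes \mathbb I_B)(\sigma_{C'}\otimes\rho_{AB})\right],$$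 and its fidelity is the entanglement fidelity $$F(\Lambda)=\mathrm{tr}\left[\Phi^+_{C''C}\,(\mathrm{id}_{C''}\otimes\Lambda)(\Phi^+_{C''C'})\right],$$ where $\Phi^+$ is the projection onto $|C|^{-1/2}\sum_{i=1}^{|C|}|i\rangle|i\rangle$. **Corollary.** Let $(\rho_{AB},\{\Pi^i\}_{i=1}^N,\{\mathcal D^i\}_{i=1}^N)$ be any $|C|$-dimensional teleportation protocol in which $\rho_{AB}$ is bound entangled. Then $$F(\Lambda)\le \frac{1}{|C|}.$$ -/

import Mathlib

/-! Operators on a finite-dimensional Hilbert space with orthonormal basis indexed by `a` are the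
matrices `Matrix a a ℂ`; the composite system of `a` and `b` is indexed by `a × b`. -/

open scoped Kronecker ComplexOrder

namespace QTeleport

noncomputable section

/-- Linear maps from operators on the system `a` to operators on the system `b`. -/
abbrev SuperOp (a b : Type) : Type := Matrix a a ℂ →ₗ[ℂ] Matrix b b ℂ

/-- The map `id_r ⊗ E`, acting blockwise; see `idTensor_kronecker`. -/
def idTensor (r : Type) {a b : Type} (E : SuperOp a b) : SuperOp (r × a) (r × b) where
  toFun X := Matrix.of fun p q => E (Matrix.of fun s t => X (p.1, s) (q.1, t)) p.2 q.2
  map_add' X Y := by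
    ext p q
    exact congrFun (congrFun (E.map_add (Matrix.of fun s t => X (p.1, s) (q.1, t))
      (Matrix.of fun s t => Y (p.1, s) (q.1, t))) p.2) q.2
  map_smul' z X := by
    ext p q
    exact congrFun (congrFun (E.map_smul z (Matrix.of fun s t => X (p.1, s) (q.1, t))) p.2) q.2

theorem idTensor_kronecker {r a b : Type} (E : SuperOp a b) (M : Matrix r r ℂ)
    (X : Matrix a a ℂ) : idTensor r E (M ⊗ₖ X) = M ⊗ₖ E X := by
  ext p q
  exact congrFun (congrFun (E.map_smul (M p.1 q.1) X) p.2) q.2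

/-- The map `E ⊗ id_r`, acting blockwise; see `tensorId_kronecker`. -/
def tensorId (r : Type) {a b : Type} (E : SuperOp a b) : SuperOp (a × r) (b × r) where
  toFun X := Matrix.of fun p q => E (Matrix.of fun s t => X (s, p.2) (t, q.2)) p.1 q.1
  map_add' X Y := by
    ext p q
    exact congrFun (congrFun (E.map_add (Matrix.of fun s t => X (s, p.2) (t, q.2))
      (Matrix.of fun s t => Y (s, p.2) (t, q.2))) p.1) q.1
  map_smul' z X := by
    ext p q
    exact congrFun (congrFun (E.map_smul z (Matrix.of fun s t => X (s, p.2) (t, q.2))) p.1) q.1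

theorem tensorId_kronecker {r a b : Type} (E : SuperOp a b) (X : Matrix a a ℂ)
    (M : Matrix r r ℂ) : tensorId r E (X ⊗ₖ M) = E X ⊗ₖ M := by
  ext p q
  have h : (Matrix.of fun s t => (X ⊗ₖ M) (s, p.2) (t, q.2)) = M p.2 q.2 • X := by
    ext s t
    simp [mul_comm]
  change E (Matrix.of fun s t => (X ⊗ₖ M) (s, p.2) (t, q.2)) p.1 q.1 = _
  rw [h, E.map_smul]
  simp [mul_comm]

/-- Complete positivity: `id_k ⊗ E` preserves positive semidefiniteness for every `k`. -/
def IsCP {a b : Type} [Fintype a] [Fintype b] (E : SuperOp a b) : Prop :=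
  ∀ (k : ℕ) (X : Matrix (Fin k × a) (Fin k × a) ℂ),
    X.PosSemidef → (idTensor (Fin k) E X).PosSemidef

/-- A quantum channel: linear, completely positive and trace preserving. -/
structure IsChannel {a b : Type} [Fintype a] [Fintype b] (E : SuperOp a b) : Prop where
  cp : IsCP E
  trace_eq : ∀ X, (E X).trace = X.trace

/-- A quantum instrument: finitely many completely positive maps, one for each measurement
outcome, that sum to a trace-preserving map. -/
structure IsInstrument {ι a b : Type} [Fintype ι] [Fintype a] [Fintype b]
    (E : ι → SuperOp a b) : Prop where
  cp : ∀ x, IsCP (E x)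
  trace_eq : ∀ X, ∑ x, (E x X).trace = X.trace

/-- A quantum state (density operator). -/
structure IsState {a : Type} [Fintype a] (ρ : Matrix a a ℂ) : Prop where
  posSemidef : ρ.PosSemidef
  trace_eq_one : ρ.trace = 1

/-- A positive operator-valued measure with outcomes `ι`. -/
structure IsPOVM {ι a : Type} [Fintype ι] [Fintype a] [DecidableEq a]
    (M : ι → Matrix a a ℂ) : Prop where
  posSemidef : ∀ i, (M i).PosSemidef
  sum_eq_one : ∑ i, M i = 1

/-- The maximally entangled vector `|c|^{-1/2} ∑ i, |i⟩|i⟩`. -/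
def maxEntVec (c : Type) [Fintype c] [DecidableEq c] : c × c → ℂ :=
  fun p => if p.1 = p.2 then ((1 / Real.sqrt (Fintype.card c) : ℝ) : ℂ) else 0

/-- The maximally entangled state `Φ⁺` as a density operator. -/
def maxEnt (c : Type) [Fintype c] [DecidableEq c] : Matrix (c × c) (c × c) ℂ :=
  Matrix.vecMulVec (maxEntVec c) (star (maxEntVec c))

/-- The partial trace over the first tensor factor. -/
def traceLeft {a b : Type} [Fintype a] (X : Matrix (a × b) (a × b) ℂ) : Matrix b b ℂ :=
  Matrix.of fun s t => ∑ i, X (i, s) (i, t)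

/-- Separable states: finite convex combinations of product states. -/
def IsSeparable {a b : Type} [Fintype a] [Fintype b] (ρ : Matrix (a × b) (a × b) ℂ) : Prop :=
  ∃ (m : ℕ) (p : Fin m → ℝ) (σ : Fin m → Matrix a a ℂ) (τ : Fin m → Matrix b b ℂ),
    (∀ i, 0 ≤ p i) ∧ ∑ i, p i = 1 ∧ (∀ i, IsState (σ i)) ∧ (∀ i, IsState (τ i)) ∧
    ρ = ∑ i, (p i : ℂ) • (σ i ⊗ₖ τ i)

/-- Deterministic finite-round LOCC maps from `a : b` to `a' : b'`. A protocol either ends with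
local channels, or starts with a local instrument of one party, who announces the outcome `x`,
after which the parties continue with a protocol `L x` that depends on `x`. All intermediate
systems are arbitrary finite systems, so local ancillas are included. -/
inductive IsLOCC {a' b' : Type} [Fintype a'] [Fintype b'] :
    ∀ {a b : Type} [Fintype a] [Fintype b], SuperOp (a × b) (a' × b') → Prop
  | protected localChannels {a b : Type} [Fintype a] [Fintype b]
      (E : SuperOp a a') (D : SuperOp b b') (hE : IsChannel E) (hD : IsChannel D) :
      IsLOCC (idTensor a' D ∘ₗ tensorId b E)
  | protected alice {a b m ι : Type} [Fintype a] [Fintype b] [Fintype m] [Fintype ι]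
      (E : ι → SuperOp a m) (hE : IsInstrument E)
      (L : ι → SuperOp (m × b) (a' × b')) (hL : ∀ x, IsLOCC (L x)) :
      IsLOCC (∑ x, L x ∘ₗ tensorId b (E x))
  | protected bob {a b m ι : Type} [Fintype a] [Fintype b] [Fintype m] [Fintype ι]
      (D : ι → SuperOp b m) (hD : IsInstrument D)
      (L : ι → SuperOp (a × m) (a' × b')) (hL : ∀ x, IsLOCC (L x)) :
      IsLOCC (∑ x, L x ∘ₗ idTensor a (D x))

/-- `ρ^{⊗n}`, with the `n` systems of Alice grouped together and those of Bob likewise. -/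
def tensorPower {a b : Type} (ρ : Matrix (a × b) (a × b) ℂ) (n : ℕ) :
    Matrix ((Fin n → a) × (Fin n → b)) ((Fin n → a) × (Fin n → b)) ℂ :=
  Matrix.of fun x y => ∏ i, ρ (x.1 i, x.2 i) (y.1 i, y.2 i)

/-- Distillability: LOCC on sufficiently many copies of `ρ` yields a two-qubit state
arbitrarily close to the maximally entangled one. -/
def IsDistillable {a b : Type} [Fintype a] [Fintype b]
    (ρ : Matrix (a × b) (a × b) ℂ) : Prop :=
  ∀ ε : ℝ, 0 < ε → ∃ (n : ℕ) (L : SuperOp ((Fin n → a) × (Fin n → b)) (Fin 2 × Fin 2)),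
    IsLOCC L ∧ 1 - ε ≤ (maxEnt (Fin 2) * L (tensorPower ρ n)).trace.re

/-- Bound entangled states: entangled (not separable) but not distillable. -/
structure IsBoundEntangled {a b : Type} [Fintype a] [Fintype b]
    (ρ : Matrix (a × b) (a × b) ℂ) : Prop where
  isState : IsState ρ
  entangled : ¬ IsSeparable ρ
  undistillable : ¬ IsDistillable ρ

/-- A `|c|`-dimensional teleportation protocol: a shared state `ρ_{AB}`, a POVM of Alice on the
input system together with `a`, and a decoding channel of Bob for each of the `N` messages. -/
structure TeleportationProtocol (a b c : Type) [Fintype a] [Fintype b] [Fintype c]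
    [DecidableEq a] [DecidableEq c] (N : ℕ) where
  ρ : Matrix (a × b) (a × b) ℂ
  isState : IsState ρ
  povm : Fin N → Matrix (c × a) (c × a) ℂ
  isPOVM : IsPOVM povm
  decoder : Fin N → SuperOp b c
  isChannel : ∀ i, IsChannel (decoder i)

/-- The teleportation channel
`Λ(σ) = ∑ i, (tr_{C'A} ⊗ D^i) [(Π^i_{C'A} ⊗ 1_B) (σ_{C'} ⊗ ρ_{AB})]`. -/
def TeleportationProtocol.channel {a b c : Type} [Fintype a] [Fintype b] [Fintype c]
    [DecidableEq a] [DecidableEq b] [DecidableEq c] {N : ℕ}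
    (P : TeleportationProtocol a b c N) : SuperOp c c where
  toFun σ := ∑ i, traceLeft (idTensor (c × a) (P.decoder i)
    ((P.povm i ⊗ₖ (1 : Matrix b b ℂ)) *
      (σ ⊗ₖ P.ρ).submatrix (Equiv.prodAssoc c a b) (Equiv.prodAssoc c a b)))
  map_add' σ τ := by
    rw [← Finset.sum_add_distrib]
    refine Finset.sum_congr rfl fun i _ => ?_
    rw [Matrix.add_kronecker, Matrix.submatrix_add, Pi.add_apply, Pi.add_apply, mul_add, map_add]
    ext s t
    simp [traceLeft, Finset.sum_add_distrib]
  map_smul' z σ := by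
    rw [Finset.smul_sum]
    refine Finset.sum_congr rfl fun i _ => ?_
    rw [Matrix.smul_kronecker, Matrix.submatrix_smul, Pi.smul_apply, Pi.smul_apply,
      Matrix.mul_smul, map_smul]
    ext s t
    simp [traceLeft, Finset.mul_sum]

/-- The entanglement fidelity `F(Λ) = tr[Φ⁺ (id ⊗ Λ)(Φ⁺)]`. -/
def entFidelity {c : Type} [Fintype c] [DecidableEq c] (Λ : SuperOp c c) : ℝ :=
  (maxEnt c * idTensor c Λ (maxEnt c)).trace.re

/-- The fidelity of a teleportation protocol. -/
def TeleportationProtocol.fidelity {a b c : Type} [Fintype a] [Fintype b] [Fintype c]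
    [DecidableEq a] [DecidableEq b] [DecidableEq c] {N : ℕ}
    (P : TeleportationProtocol a b c N) : ℝ :=
  entFidelity P.channel

end

end QTeleport

/-!
Only the undistillability of the shared state matters, and the proof goes by contraposition.

*From teleportation to filters.* When the input is half of a maximally entangled state, each
outcome of Alice leaves an unnormalised state of `C''B` (`aliceOutput`), which is a sum of images
of `ρ` under local filters of Alice. If such an image `σ` satisfies the reduction criterion
`σ ≤ 1 ⊗ σ_B`, then no channel of Bob brings its overlap with `∑ i, |i⟩|i⟩` above `tr σ`
(`maxEntOverlap_idTensor_aliceOutput_le`). Summing over the outcomes of the measurement gives the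
bound `1 / |C|`. A violation of the reduction criterion is a pair of local filters into `C` whose
output has overlap larger than its trace. This excess is a sum over pairs `i, j` of the excesses of
the restrictions to `span {|i⟩, |j⟩}`, so it persists for filters into two qubits
(`maxEntOverlap_localConj_le`).

*From a two-qubit filter to distillation.* It remains to distil from a filter that produces, with
some probability, two qubits of fidelity above one half (`isDistillable_of_excess`). Twirling by
local unitaries makes the operator Bell-diagonal with parameters `α ≥ β > γ`. Many copies are then
projected on the code that detects bit errors by repetition and phase errors by repetition in the
conjugate basis. The condition `β > γ` lets both error rates tend to zero
(`exists_errorDetection_parameters`). Twirling yields a sum of filtered operators rather than a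
single one, but the comparison of fidelity with success probability is linear, so one summand is as
good as the sum; hence the additive submonoid `filterCone`.

*From a probabilistic to a deterministic protocol.* If a filter succeeds with probability `D` and
contributes the overlap `N`, applying it to fresh copies and falling back on another protocol with
fidelity `f` achieves `N + (1 - D) f`. The supremum of the achievable fidelities is therefore at
least `N / D` (`isDistillable_of_filter`).
-/

namespace QTeleport

open Matrix Finset

noncomputable section

/-! ### Kraus maps and local filters -/

/-- The map `X ↦ V X Vᴴ` with a single Kraus operator `V`. -/
def krausMap {a m : Type} [Fintype a] (V : Matrix m a ℂ) : SuperOp a m where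
  toFun X := V * X * Vᴴ
  map_add' X Y := by rw [Matrix.mul_add, Matrix.add_mul]
  map_smul' z X := by rw [Matrix.mul_smul, Matrix.smul_mul, RingHom.id_apply]

/-- The local filter `X ↦ (M ⊗ K) X (M ⊗ K)ᴴ`. -/
def localConj {a b a' b' : Type} [Fintype a] [Fintype b] (M : Matrix a' a ℂ) (K : Matrix b' b ℂ) :
    SuperOp (a × b) (a' × b') :=
  krausMap (M ⊗ₖ K)

section

variable {a b a' b' a'' b'' m ι r : Type} [Fintype a] [Fintype b]

theorem krausMap_apply (V : Matrix m a ℂ) (X : Matrix a a ℂ) : krausMap V X = V * X * Vᴴ := rfl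

theorem localConj_def (M : Matrix a' a ℂ) (K : Matrix b' b ℂ) (X : Matrix (a × b) (a × b) ℂ) :
    localConj M K X = (M ⊗ₖ K) * X * (M ⊗ₖ K)ᴴ := rfl

theorem localConj_apply (M : Matrix a' a ℂ) (K : Matrix b' b ℂ) (X : Matrix (a × b) (a × b) ℂ)
    (p q : a' × b') :
    localConj M K X p q = ∑ w : a × b, ∑ z : a × b,
      M p.1 z.1 * K p.2 z.2 * X z w * (star (M q.1 w.1) * star (K q.2 w.2)) := by
  simp [localConj_def, Matrix.mul_apply, Finset.sum_mul, kroneckerMap_apply]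

theorem localConj_smul_left (z : ℂ) (M : Matrix a' a ℂ) (K : Matrix b' b ℂ)
    (X : Matrix (a × b) (a × b) ℂ) :
    localConj (z • M) K X = (z * star z) • localConj M K X := by
  simp only [localConj_def, Matrix.smul_kronecker, Matrix.conjTranspose_smul, Matrix.smul_mul,
    Matrix.mul_smul, smul_smul]
  rw [mul_comm]

theorem localConj_smul_right (z : ℂ) (M : Matrix a' a ℂ) (K : Matrix b' b ℂ)
    (X : Matrix (a × b) (a × b) ℂ) :
    localConj M (z • K) X = (z * star z) • localConj M K X := by
  simp only [localConj_def, Matrix.kronecker_smul, Matrix.conjTranspose_smul, Matrix.smul_mul,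
    Matrix.mul_smul, smul_smul]
  rw [mul_comm]

variable [Fintype a'] [Fintype b']

theorem localConj_localConj (M : Matrix a' a ℂ) (K : Matrix b' b ℂ) (U : Matrix a'' a' ℂ)
    (V : Matrix b'' b' ℂ) (X : Matrix (a × b) (a × b) ℂ) :
    localConj U V (localConj M K X) = localConj (U * M) (V * K) X := by
  simp only [localConj_def, Matrix.mul_kronecker_mul, Matrix.conjTranspose_mul, Matrix.mul_assoc]

theorem localConj_posSemidef (M : Matrix a' a ℂ) (K : Matrix b' b ℂ)
    {X : Matrix (a × b) (a × b) ℂ} (hX : X.PosSemidef) : (localConj M K X).PosSemidef :=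
  hX.mul_mul_conjTranspose_same _

theorem idTensor_krausMap [Fintype r] [DecidableEq r] (V : Matrix m a ℂ)
    (X : Matrix (r × a) (r × a) ℂ) :
    idTensor r (krausMap V) X = localConj (1 : Matrix r r ℂ) V X := by
  ext p q
  change (V * (Matrix.of fun s t => X (p.1, s) (q.1, t)) * Vᴴ) p.2 q.2 = _
  simp only [localConj_apply, Matrix.mul_apply, Finset.sum_mul, Fintype.sum_prod_type,
    Matrix.one_apply, Matrix.of_apply, Matrix.conjTranspose_apply]
  simp [Finset.sum_ite_irrel, ite_mul, mul_ite]

theorem tensorId_krausMap [Fintype r] [DecidableEq r] (V : Matrix m a ℂ)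
    (X : Matrix (a × r) (a × r) ℂ) :
    tensorId r (krausMap V) X = localConj V (1 : Matrix r r ℂ) X := by
  ext p q
  change (V * (Matrix.of fun s t => X (s, p.2) (t, q.2)) * Vᴴ) p.1 q.1 = _
  simp only [localConj_apply, Matrix.mul_apply, Finset.sum_mul, Fintype.sum_prod_type,
    Matrix.one_apply, Matrix.of_apply, Matrix.conjTranspose_apply]
  simp [Finset.sum_ite_irrel, ite_mul, mul_ite]

variable [Fintype m] [Fintype ι]

theorem isCP_krausMap (V : Matrix m a ℂ) : IsCP (krausMap V) := fun k X hX => by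
  rw [idTensor_krausMap]
  exact localConj_posSemidef _ _ hX

theorem isInstrument_krausMap [DecidableEq a] {V : ι → Matrix m a ℂ}
    (hV : ∑ x, (V x)ᴴ * V x = 1) : IsInstrument fun x => krausMap (V x) where
  cp x := isCP_krausMap _
  trace_eq X := by
    have h : ∀ x, (krausMap (V x) X).trace = ((V x)ᴴ * V x * X).trace := fun x => by
      rw [krausMap_apply, Matrix.trace_mul_comm, Matrix.mul_assoc]
    simp only [h]
    rw [← Matrix.trace_sum, ← Matrix.sum_mul, hV, one_mul]

theorem isChannel_krausMap [DecidableEq a] {V : Matrix m a ℂ} (hV : Vᴴ * V = 1) :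
    IsChannel (krausMap V) where
  cp := isCP_krausMap _
  trace_eq X := by rw [krausMap_apply, Matrix.trace_mul_comm, ← Matrix.mul_assoc, hV, one_mul]

/-! ### Fidelities reachable by LOCC -/

/-- Some LOCC map sends the operator `X` to a two-qubit operator whose overlap with the maximally
entangled state is `f`. The operator need not be normalised, so that the branches of a measurement
can be treated one by one. -/
def HasLOCCValue (X : Matrix (a × b) (a × b) ℂ) (f : ℝ) : Prop :=
  ∃ L : SuperOp (a × b) (Fin 2 × Fin 2), IsLOCC L ∧ (maxEnt (Fin 2) * L X).trace.re = f

theorem HasLOCCValue.self (X : Matrix (Fin 2 × Fin 2) (Fin 2 × Fin 2) ℂ) :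
    HasLOCCValue X (maxEnt (Fin 2) * X).trace.re := by
  have h : IsChannel (krausMap (1 : Matrix (Fin 2) (Fin 2) ℂ)) := isChannel_krausMap (by simp)
  refine ⟨_, IsLOCC.localChannels _ _ h h, ?_⟩
  rw [LinearMap.comp_apply, tensorId_krausMap, idTensor_krausMap, localConj_localConj]
  simp [localConj_def]

theorem HasLOCCValue.smul {X : Matrix (a × b) (a × b) ℂ} {f : ℝ} (h : HasLOCCValue X f) (p : ℝ) :
    HasLOCCValue ((p : ℂ) • X) (p * f) := by
  obtain ⟨L, hL, rfl⟩ := h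
  exact ⟨L, hL, by simp⟩

/-- A measurement of Alice with one Kraus operator per outcome. -/
theorem HasLOCCValue.alice [DecidableEq a] [DecidableEq b] {V : ι → Matrix m a ℂ}
    (hV : ∑ x, (V x)ᴴ * V x = 1) {X : Matrix (a × b) (a × b) ℂ} {f : ι → ℝ}
    (h : ∀ x, HasLOCCValue (localConj (V x) (1 : Matrix b b ℂ) X) (f x)) :
    HasLOCCValue X (∑ x, f x) := by
  choose L hL hf using h
  refine ⟨_, IsLOCC.alice _ (isInstrument_krausMap hV) L hL, ?_⟩
  simp only [LinearMap.sum_apply, LinearMap.comp_apply, tensorId_krausMap, Matrix.mul_sum,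
    Matrix.trace_sum, Complex.re_sum, hf]

/-- A measurement of Bob with one Kraus operator per outcome. -/
theorem HasLOCCValue.bob [DecidableEq a] [DecidableEq b] {W : ι → Matrix m b ℂ}
    (hW : ∑ x, (W x)ᴴ * W x = 1) {X : Matrix (a × b) (a × b) ℂ} {f : ι → ℝ}
    (h : ∀ x, HasLOCCValue (localConj (1 : Matrix a a ℂ) (W x) X) (f x)) :
    HasLOCCValue X (∑ x, f x) := by
  choose L hL hf using h
  refine ⟨_, IsLOCC.bob _ (isInstrument_krausMap hW) L hL, ?_⟩
  simp only [LinearMap.sum_apply, LinearMap.comp_apply, idTensor_krausMap, Matrix.mul_sum,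
    Matrix.trace_sum, Complex.re_sum, hf]

/-- Alice and Bob both measure, and continue depending on both outcomes. -/
theorem HasLOCCValue.measure {κ m' : Type} [Fintype κ] [Fintype m'] [DecidableEq a]
    [DecidableEq b] [DecidableEq m] {V : ι → Matrix m a ℂ} {W : κ → Matrix m' b ℂ}
    (hV : ∑ x, (V x)ᴴ * V x = 1) (hW : ∑ y, (W y)ᴴ * W y = 1)
    {X : Matrix (a × b) (a × b) ℂ} {f : ι → κ → ℝ}
    (h : ∀ x y, HasLOCCValue (localConj (V x) (W y) X) (f x y)) :
    HasLOCCValue X (∑ x, ∑ y, f x y) := by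
  refine HasLOCCValue.alice hV fun x => HasLOCCValue.bob hW fun y => ?_
  rw [localConj_localConj, Matrix.one_mul, Matrix.mul_one]
  exact h x y

end

/-! ### Tensor products across the bipartition -/

/-- The tensor product of an operator on `a : b` and one on `a' : b'`, as an operator on
`a a' : b b'`. -/
def bipartiteTensor {a b a' b' : Type} (Y : Matrix (a × b) (a × b) ℂ)
    (Z : Matrix (a' × b') (a' × b') ℂ) :
    Matrix ((a × a') × (b × b')) ((a × a') × (b × b')) ℂ :=
  (Y ⊗ₖ Z).submatrix (Equiv.prodProdProdComm a a' b b') (Equiv.prodProdProdComm a a' b b')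

section

variable {a b a' b' c d c' d' : Type}

theorem bipartiteTensor_apply (Y : Matrix (a × b) (a × b) ℂ) (Z : Matrix (a' × b') (a' × b') ℂ)
    (p q : (a × a') × (b × b')) : bipartiteTensor Y Z p q =
      Y (p.1.1, p.2.1) (q.1.1, q.2.1) * Z (p.1.2, p.2.2) (q.1.2, q.2.2) := rfl

theorem tensorPower_add (ρ : Matrix (a × b) (a × b) ℂ) (n k : ℕ) :
    (tensorPower ρ (n + k)).submatrix
        (Prod.map (Fin.appendEquiv n k) (Fin.appendEquiv n k))
        (Prod.map (Fin.appendEquiv n k) (Fin.appendEquiv n k)) =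
      bipartiteTensor (tensorPower ρ n) (tensorPower ρ k) := by
  ext p q
  simp [bipartiteTensor_apply, tensorPower, Fin.prod_univ_add, Fin.appendEquiv]

theorem tensorPower_one (ρ : Matrix (a × b) (a × b) ℂ) :
    (tensorPower ρ 1).submatrix
        (Prod.map (Equiv.funUnique (Fin 1) a).symm (Equiv.funUnique (Fin 1) b).symm)
        (Prod.map (Equiv.funUnique (Fin 1) a).symm (Equiv.funUnique (Fin 1) b).symm) = ρ := by
  ext p q
  simp [tensorPower]

variable [Fintype a] [Fintype b] [Fintype a'] [Fintype b']

theorem localConj_bipartiteTensor (M : Matrix c a ℂ) (K : Matrix d b ℂ) (M' : Matrix c' a' ℂ)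
    (K' : Matrix d' b' ℂ) (Y : Matrix (a × b) (a × b) ℂ) (Z : Matrix (a' × b') (a' × b') ℂ) :
    localConj (M ⊗ₖ M') (K ⊗ₖ K') (bipartiteTensor Y Z) =
      bipartiteTensor (localConj M K Y) (localConj M' K' Z) := by
  have h : (M ⊗ₖ M') ⊗ₖ (K ⊗ₖ K') = ((M ⊗ₖ K) ⊗ₖ (M' ⊗ₖ K')).submatrix
      (Equiv.prodProdProdComm c c' d d') (Equiv.prodProdProdComm a a' b b') := by
    ext p q
    simp only [kroneckerMap_apply, Matrix.submatrix_apply, Equiv.prodProdProdComm_apply]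
    ring
  rw [localConj_def, h, bipartiteTensor, bipartiteTensor, localConj_def, localConj_def,
    Matrix.mul_kronecker_mul, Matrix.mul_kronecker_mul, Matrix.conjTranspose_submatrix,
    Matrix.conjTranspose_kronecker, Matrix.submatrix_mul_equiv, Matrix.submatrix_mul_equiv]

/-- Selecting or relabelling basis vectors of Alice and of Bob is a local filter. -/
theorem localConj_submatrix_one [DecidableEq a] [DecidableEq b] (e : c → a) (g : d → b)
    (X : Matrix (a × b) (a × b) ℂ) :
    localConj ((1 : Matrix a a ℂ).submatrix e id) ((1 : Matrix b b ℂ).submatrix g id) X =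
      X.submatrix (Prod.map e g) (Prod.map e g) := by
  ext p q
  simp [localConj_apply, Matrix.one_apply, Fintype.sum_prod_type, Prod.map]

theorem trace_tensorPower (ρ : Matrix (a × b) (a × b) ℂ) (n : ℕ) :
    (tensorPower ρ n).trace = ρ.trace ^ n := by
  have h : ∀ x : (Fin n → a) × (Fin n → b),
      tensorPower ρ n x x = ∏ i, ρ (x.1 i, x.2 i) (x.1 i, x.2 i) := fun x => rfl
  simp only [Matrix.trace, Matrix.diag, h]
  rw [← (Equiv.arrowProdEquivProdArrow (Fin n) (fun _ => a) (fun _ => b)).sum_comp]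
  have := Finset.prod_univ_sum (fun _ : Fin n => (Finset.univ : Finset (a × b)))
    (fun _ z => ρ z z)
  simp only [Finset.prod_const, Finset.card_univ, Fintype.card_fin, Fintype.piFinset_univ] at this
  rw [this]
  rfl

end

/-! ### Repeating a filter until it succeeds -/

section

variable {a b a' b' c d κ κ' ι : Type} [Fintype a] [Fintype b] [Fintype a'] [Fintype b']
  [Fintype c] [Fintype d] [Fintype κ] [Fintype κ'] [Fintype ι]

/-- Alice and Bob measure the factors `κ` and `κ'` of their systems in the standard basis. -/
theorem HasLOCCValue.basis [DecidableEq a] [DecidableEq b] [DecidableEq c] (e : c × κ ≃ a)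
    (g : d × κ' ≃ b) {X : Matrix (a × b) (a × b) ℂ} {f : κ → κ' → ℝ}
    (h : ∀ k l, HasLOCCValue (X.submatrix
      (Prod.map (fun i => e (i, k)) fun j => g (j, l))
      (Prod.map (fun i => e (i, k)) fun j => g (j, l))) (f k l)) :
    HasLOCCValue X (∑ k, ∑ l, f k l) := by
  have key : ∀ {a c κ : Type} [Fintype a] [Fintype c] [Fintype κ] [DecidableEq a]
      (e : c × κ ≃ a), ∑ k, ((1 : Matrix a a ℂ).submatrix (fun i => e (i, k)) id)ᴴ *
        (1 : Matrix a a ℂ).submatrix (fun i => e (i, k)) id = 1 := by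
    intro a c κ _ _ _ _ e
    ext p q
    simp only [Matrix.sum_apply, Matrix.mul_apply, Matrix.conjTranspose_apply,
      Matrix.submatrix_apply]
    refine (Fintype.sum_prod_type_right fun z : c × κ =>
      star ((1 : Matrix a a ℂ) (e z) p) * (1 : Matrix a a ℂ) (e z) q).symm.trans
      ((e.sum_comp fun z => star ((1 : Matrix a a ℂ) z p) * (1 : Matrix a a ℂ) z q).trans ?_)
    simp [Matrix.one_apply, eq_comm]
  refine HasLOCCValue.measure (key e) (key g) fun k l => ?_
  rw [localConj_submatrix_one]
  exact h k l

theorem HasLOCCValue.of_submatrix [DecidableEq a] [DecidableEq b] [DecidableEq c] (e : c ≃ a)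
    (g : d ≃ b) {X : Matrix (a × b) (a × b) ℂ} {f : ℝ}
    (h : HasLOCCValue (X.submatrix (Prod.map e g) (Prod.map e g)) f) : HasLOCCValue X f := by
  have := HasLOCCValue.basis ((Equiv.prodPUnit c).trans e) ((Equiv.prodPUnit d).trans g)
    (X := X) (f := fun _ _ => f) fun _ _ => h
  simpa using this

theorem coe_re_diag_of_posSemidef {s : Type} {Z : Matrix s s ℂ} (hZ : Z.PosSemidef) (i : s) :
    ((Z i i).re : ℂ) = Z i i :=
  Complex.conj_eq_iff_re.mp (by simpa using hZ.1.apply i i)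

/-- Alice and Bob discard their parts of the second tensor factor. -/
theorem HasLOCCValue.bipartiteTensor_left [DecidableEq a] [DecidableEq b] [DecidableEq a']
    [DecidableEq b'] {Y : Matrix (a × b) (a × b) ℂ} {Z : Matrix (a' × b') (a' × b') ℂ} {f : ℝ}
    (hZ : Z.PosSemidef) (h : HasLOCCValue Y f) :
    HasLOCCValue (bipartiteTensor Y Z) (Z.trace.re * f) := by
  have := HasLOCCValue.basis (Equiv.refl (a × a')) (Equiv.refl (b × b'))
    (X := bipartiteTensor Y Z) (f := fun k l => (Z (k, l) (k, l)).re * f) fun k l => by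
      convert h.smul (Z (k, l) (k, l)).re using 1
      ext p q
      simp [bipartiteTensor_apply, coe_re_diag_of_posSemidef hZ, mul_comm]
  convert this using 1
  simp [Matrix.trace, Fintype.sum_prod_type, Finset.sum_mul]

/-- Alice and Bob discard their parts of the first tensor factor. -/
theorem HasLOCCValue.bipartiteTensor_right [DecidableEq a] [DecidableEq b] [DecidableEq a']
    [DecidableEq b'] {Y : Matrix (a × b) (a × b) ℂ} {Z : Matrix (a' × b') (a' × b') ℂ} {f : ℝ}
    (hY : Y.PosSemidef) (h : HasLOCCValue Z f) :
    HasLOCCValue (bipartiteTensor Y Z) (Y.trace.re * f) := by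
  have := HasLOCCValue.basis (Equiv.prodComm a' a) (Equiv.prodComm b' b)
    (X := bipartiteTensor Y Z) (f := fun k l => (Y (k, l) (k, l)).re * f) fun k l => by
      convert h.smul (Y (k, l) (k, l)).re using 1
      ext p q
      simp [bipartiteTensor_apply, coe_re_diag_of_posSemidef hY]
  convert this using 1
  simp [Matrix.trace, Fintype.sum_prod_type, Finset.sum_mul]

open scoped MatrixOrder Matrix.Norms.L2Operator in
theorem exists_posSemidef_one_sub_smul [DecidableEq a] {A : Matrix a a ℂ} (hA : A.PosSemidef) :
    ∃ t : ℝ, 0 < t ∧ (1 - ((t : ℂ) * (t : ℂ)) • A).PosSemidef := by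
  have h := IsSelfAdjoint.le_algebraMap_norm_self (a := A) hA.1
  rw [Matrix.le_iff] at h
  set s := ‖A‖
  have hs : 0 ≤ s := norm_nonneg A
  refine ⟨(Real.sqrt (s + 1))⁻¹, by positivity, ?_⟩
  have h1 : (((Real.sqrt (s + 1))⁻¹ : ℝ) : ℂ) * (((Real.sqrt (s + 1))⁻¹ : ℝ) : ℂ) =
      (((s + 1)⁻¹ : ℝ) : ℂ) := by
    rw [← Complex.ofReal_mul, ← mul_inv, Real.mul_self_sqrt (by positivity)]
  have h2 : (((s + 1)⁻¹ : ℝ) : ℂ) * ((s : ℂ) + 1) = 1 := by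
    rw [← Complex.ofReal_one, ← Complex.ofReal_add, ← Complex.ofReal_mul,
      inv_mul_cancel₀ (by positivity)]
  have h3 : (1 : Matrix a a ℂ) - (((s + 1)⁻¹ : ℝ) : ℂ) • A =
      (((s + 1)⁻¹ : ℝ) : ℂ) • ((algebraMap ℝ (Matrix a a ℂ) s - A) + 1) := by
    have h5 : algebraMap ℝ (Matrix a a ℂ) s + 1 = ((s : ℂ) + 1) • 1 := by
      rw [Algebra.algebraMap_eq_smul_one, add_smul, one_smul]
      congr 1
    rw [sub_add_eq_add_sub, h5, smul_sub, smul_smul, h2, one_smul]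
  rw [h1, h3]
  exact (h.add Matrix.PosSemidef.one).smul (by exact_mod_cast (by positivity : 0 ≤ (s + 1)⁻¹))

open scoped MatrixOrder in
theorem exists_eq_conjTranspose_mul_self [DecidableEq a] {A : Matrix a a ℂ} (hA : A.PosSemidef) :
    ∃ Q : Matrix a a ℂ, A = Qᴴ * Q :=
  CStarAlgebra.nonneg_iff_eq_star_mul_self.mp hA.nonneg

/-- Up to a positive scalar, every filter into a qubit is an outcome of a measurement. -/
theorem exists_measurement_of_filter [DecidableEq a] (M : Matrix (Fin 2) a ℂ) :
    ∃ (t : ℝ) (V : Option a → Matrix (Fin 2) a ℂ), 0 < t ∧ V none = (t : ℂ) • M ∧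
      ∑ x, (V x)ᴴ * V x = 1 := by
  obtain ⟨t, ht, hR⟩ := exists_posSemidef_one_sub_smul (Matrix.posSemidef_conjTranspose_mul_self M)
  obtain ⟨Q, hQ⟩ := exists_eq_conjTranspose_mul_self hR
  refine ⟨t, fun x => x.elim ((t : ℂ) • M) fun k => Matrix.of fun i j => if i = 0 then Q k j else 0,
    ht, rfl, ?_⟩
  rw [Fintype.sum_option]
  have h : ∑ k, (Matrix.of fun (i : Fin 2) j => if i = 0 then Q k j else 0)ᴴ *
      (Matrix.of fun (i : Fin 2) j => if i = 0 then Q k j else 0) = Qᴴ * Q := by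
    ext p q
    simp [Matrix.sum_apply, Matrix.mul_apply]
  simp only [Option.elim_none, Option.elim_some]
  have ht' : star (t : ℂ) = t := Complex.conj_ofReal t
  rw [h, ← hQ, Matrix.conjTranspose_smul, ht', Matrix.smul_mul, Matrix.mul_smul, smul_smul,
    add_sub_cancel]

theorem trace_localConj (M : Matrix c a ℂ) (K : Matrix d b ℂ) (X : Matrix (a × b) (a × b) ℂ) :
    (localConj M K X).trace = (((Mᴴ * M) ⊗ₖ (Kᴴ * K)) * X).trace := by
  rw [localConj_def, Matrix.trace_mul_comm, ← Matrix.mul_assoc, Matrix.conjTranspose_kronecker,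
    Matrix.mul_kronecker_mul]

theorem sum_trace_localConj [DecidableEq a] [DecidableEq b] {V : ι → Matrix c a ℂ}
    {W : κ → Matrix d b ℂ} (hV : ∑ x, (V x)ᴴ * V x = 1) (hW : ∑ y, (W y)ᴴ * W y = 1)
    (X : Matrix (a × b) (a × b) ℂ) : ∑ x, ∑ y, (localConj (V x) (W y) X).trace = X.trace := by
  have h : ∑ x, ∑ y, ((V x)ᴴ * V x) ⊗ₖ ((W y)ᴴ * W y) = 1 := by
    rw [← Matrix.one_kronecker_one, ← hV, ← hW]
    ext p q
    simp only [Matrix.sum_apply, kroneckerMap_apply, Finset.sum_mul_sum]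
  simp only [trace_localConj, ← Matrix.trace_sum, ← Matrix.sum_mul, h, one_mul]

/-- One round of "repeat until success": Alice and Bob apply the filters `V none` and `W none` to
the first factor. If both succeed they keep the resulting two qubits, otherwise they go on with
the second factor. -/
theorem HasLOCCValue.filter_or_continue [DecidableEq a] [DecidableEq b] [DecidableEq a']
    [DecidableEq b'] {V : Option ι → Matrix (Fin 2) a ℂ} {W : Option κ → Matrix (Fin 2) b ℂ}
    (hV : ∑ x, (V x)ᴴ * V x = 1) (hW : ∑ y, (W y)ᴴ * W y = 1)
    {Y : Matrix (a × b) (a × b) ℂ} {Z : Matrix (a' × b') (a' × b') ℂ} (hY : IsState Y)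
    (hZ : IsState Z) {f : ℝ} (h : HasLOCCValue Z f) :
    HasLOCCValue (bipartiteTensor Y Z)
      ((maxEnt (Fin 2) * localConj (V none) (W none) Y).trace.re +
        (1 - (localConj (V none) (W none) Y).trace.re) * f) := by
  classical
  have lift : ∀ {a a' ι : Type} [Fintype a] [Fintype a'] [Fintype ι] [DecidableEq a]
      [DecidableEq a'] {V : ι → Matrix (Fin 2) a ℂ} (_ : ∑ x, (V x)ᴴ * V x = 1),
      ∑ x, (V x ⊗ₖ (1 : Matrix a' a' ℂ))ᴴ * (V x ⊗ₖ (1 : Matrix a' a' ℂ)) = 1 := by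
    intro a a' ι _ _ _ _ _ V hV
    simp only [Matrix.conjTranspose_kronecker, ← Matrix.mul_kronecker_mul,
      Matrix.conjTranspose_one, Matrix.one_mul]
    rw [← Matrix.one_kronecker_one, ← hV]
    ext p q
    simp only [Matrix.sum_apply, kroneckerMap_apply, Finset.sum_mul]
  have hsum : ∑ x, ∑ y, (localConj (V x) (W y) Y).trace.re = 1 := by
    simp only [← Complex.re_sum, sum_trace_localConj hV hW, hY.trace_eq_one, Complex.one_re]
  have := HasLOCCValue.measure (lift (a' := a') hV) (lift (a' := b') hW)
    (X := bipartiteTensor Y Z)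
    (f := fun x y => (localConj (V x) (W y) Y).trace.re * f +
      if x = none ∧ y = none then (maxEnt (Fin 2) * localConj (V none) (W none) Y).trace.re -
        (localConj (V none) (W none) Y).trace.re * f else 0) fun x y => by
      rw [localConj_bipartiteTensor]
      have h1 : localConj (1 : Matrix a' a' ℂ) (1 : Matrix b' b' ℂ) Z = Z := by
        simp [localConj_def]
      rw [h1]
      by_cases hxy : x = none ∧ y = none
      · obtain ⟨rfl, rfl⟩ := hxy
        convert (HasLOCCValue.self (localConj (V none) (W none) Y)).bipartiteTensor_left
          hZ.posSemidef using 1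
        simp [hZ.trace_eq_one]
      · rw [if_neg hxy, add_zero]
        exact h.bipartiteTensor_right (localConj_posSemidef _ _ hY.posSemidef)
  convert this using 1
  simp only [Finset.sum_add_distrib, ← Finset.sum_mul, hsum, ite_and, Finset.sum_ite_eq',
    Finset.sum_ite_irrel, Finset.sum_const_zero, Finset.mem_univ, if_true]
  ring

theorem tensorPower_posSemidef [DecidableEq a] [DecidableEq b] {ρ : Matrix (a × b) (a × b) ℂ}
    (hρ : ρ.PosSemidef) (n : ℕ) : (tensorPower ρ n).PosSemidef := by
  induction n with
  | zero =>
    have h : tensorPower ρ 0 = 1 := by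
      ext p q
      rw [Subsingleton.elim p q]
      simp [tensorPower]
    rw [h]
    exact Matrix.PosSemidef.one
  | succ n ih =>
    have h1 : (tensorPower ρ 1).PosSemidef := by
      rw [← tensorPower_one ρ] at hρ
      exact (Matrix.posSemidef_submatrix_equiv (Equiv.prodCongr _ _)).mp hρ
    have h2 : (bipartiteTensor (tensorPower ρ n) (tensorPower ρ 1)).PosSemidef :=
      (ih.kronecker h1).submatrix _
    rw [← tensorPower_add] at h2
    exact (Matrix.posSemidef_submatrix_equiv
      (Equiv.prodCongr (Fin.appendEquiv n 1) (Fin.appendEquiv n 1))).mp h2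

theorem isState_tensorPower {ρ : Matrix (a × b) (a × b) ℂ} (hρ : IsState ρ) (n : ℕ) :
    IsState (tensorPower ρ n) := by
  classical
  exact ⟨tensorPower_posSemidef hρ.posSemidef n, by
    rw [trace_tensorPower, hρ.trace_eq_one, one_pow]⟩

/-- If the local filters `M` and `K`, applied to some copies of `ρ`, produce with nonzero
probability a state with fidelity larger than `1 - ε`, for every `ε`, then `ρ` is distillable:
the filters are applied to fresh copies until they succeed. -/
theorem isDistillable_of_filter {ρ : Matrix (a × b) (a × b) ℂ} (hρ : IsState ρ)
    (h : ∀ ε : ℝ, 0 < ε → ∃ (n : ℕ) (M : Matrix (Fin 2) (Fin n → a) ℂ)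
      (K : Matrix (Fin 2) (Fin n → b) ℂ),
      (1 - ε) * (localConj M K (tensorPower ρ n)).trace.re <
        (maxEnt (Fin 2) * localConj M K (tensorPower ρ n)).trace.re) :
    IsDistillable ρ := by
  classical
  intro ε hε
  by_contra! hcon
  obtain ⟨n, M, K, hMK⟩ := h ε hε
  obtain ⟨s, V, hs, hV0, hV⟩ := exists_measurement_of_filter M
  obtain ⟨t, W, ht, hW0, hW⟩ := exists_measurement_of_filter K
  have hVW : localConj (V none) (W none) (tensorPower ρ n) =
      ((s * s * (t * t) : ℝ) : ℂ) • localConj M K (tensorPower ρ n) := by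
    rw [hV0, hW0, localConj_smul_left, localConj_smul_right, smul_smul]
    simp
  set N := (maxEnt (Fin 2) * localConj (V none) (W none) (tensorPower ρ n)).trace.re with hN
  set D := (localConj (V none) (W none) (tensorPower ρ n)).trace.re with hD
  have hND : (1 - ε) * D < N := by
    have hst : 0 < s * s * (t * t) := by positivity
    rw [hN, hD, hVW, Matrix.mul_smul, Matrix.trace_smul, Matrix.trace_smul, smul_eq_mul,
      smul_eq_mul, Complex.re_ofReal_mul, Complex.re_ofReal_mul]
    nlinarith
  have hD0 : 0 ≤ D :=
    (Complex.le_def.mp (localConj_posSemidef _ _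
      (isState_tensorPower hρ n).posSemidef).trace_nonneg).1
  -- The supremum `v` of the reachable fidelities satisfies `N + (1 - D) v ≤ v`, that is
  -- `N ≤ D v`, although `v ≤ 1 - ε`.
  let S : Set ℝ := {f | ∃ k, HasLOCCValue (tensorPower ρ k) f}
  have hS : ∀ f ∈ S, f < 1 - ε := by
    rintro f ⟨k, L, hL, rfl⟩
    exact hcon k L hL
  have hstep : ∀ f ∈ S, N + (1 - D) * f ∈ S := by
    rintro f ⟨k, hf⟩
    refine ⟨n + k, HasLOCCValue.of_submatrix (Fin.appendEquiv n k) (Fin.appendEquiv n k) ?_⟩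
    rw [tensorPower_add]
    exact hf.filter_or_continue hV hW (isState_tensorPower hρ n) (isState_tensorPower hρ k)
  have hne : S.Nonempty :=
    ⟨_, n, HasLOCCValue.measure hV hW fun x y => HasLOCCValue.self _⟩
  have hle : sSup S ≤ 1 - ε := csSup_le hne fun f hf => (hS f hf).le
  have hD1 : D ≤ 1 := by
    have h0 : ∀ x y, 0 ≤ (localConj (V x) (W y) (tensorPower ρ n)).trace.re := fun x y =>
      (Complex.le_def.mp (localConj_posSemidef _ _
        (isState_tensorPower hρ n).posSemidef).trace_nonneg).1
    have h1 : ∑ x, ∑ y, (localConj (V x) (W y) (tensorPower ρ n)).trace.re = 1 := by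
      simp only [← Complex.re_sum, sum_trace_localConj hV hW,
        (isState_tensorPower hρ n).trace_eq_one, Complex.one_re]
    rw [← h1]
    exact (Finset.single_le_sum (fun y _ => h0 none y) (Finset.mem_univ none)).trans
      (Finset.single_le_sum (f := fun x => ∑ y, (localConj (V x) (W y) (tensorPower ρ n)).trace.re)
        (fun x _ => Finset.sum_nonneg fun y _ => h0 x y) (Finset.mem_univ none))
  have hpos : 0 < N - D * sSup S := by nlinarith
  obtain ⟨f, hf, hlt⟩ := exists_lt_of_lt_csSup hne
    (show sSup S - (N - D * sSup S) / 2 < sSup S by linarith)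
  have hle' : N + (1 - D) * f ≤ sSup S :=
    le_csSup ⟨1 - ε, fun f hf => (hS f hf).le⟩ (hstep f hf)
  nlinarith

end

/-! ### Entanglement distillation by error detection -/

/-- Sums of the (unnormalised) two-qubit operators that local filters produce from some number of
copies of `ρ`. -/
def filterCone {a b : Type} [Fintype a] [Fintype b] (ρ : Matrix (a × b) (a × b) ℂ) :
    AddSubmonoid (Matrix (Fin 2 × Fin 2) (Fin 2 × Fin 2) ℂ) :=
  AddSubmonoid.closure {G | ∃ (n : ℕ) (M : Matrix (Fin 2) (Fin n → a) ℂ)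
    (K : Matrix (Fin 2) (Fin n → b) ℂ), G = localConj M K (tensorPower ρ n)}

/-- The two-qubit operator with diagonal entries `α`, `γ`, `γ`, `α`, with `β` in the two corners
and with `δ` in the other two antidiagonal entries. These are the operators that are diagonal in
the Bell basis. -/
def bellDiag (α β γ δ : ℝ) : Matrix (Fin 2 × Fin 2) (Fin 2 × Fin 2) ℂ :=
  Matrix.of fun p q =>
    if p.1 = p.2 then (if q.1 = q.2 then (if p = q then (α : ℂ) else (β : ℂ)) else 0)
    else (if q.1 = q.2 then 0 else (if p = q then (γ : ℂ) else (δ : ℂ)))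

section

variable {a b : Type} [Fintype a] [Fintype b] {ρ : Matrix (a × b) (a × b) ℂ}

theorem localConj_mem_filterCone (U V : Matrix (Fin 2) (Fin 2) ℂ)
    {G : Matrix (Fin 2 × Fin 2) (Fin 2 × Fin 2) ℂ} (hG : G ∈ filterCone ρ) :
    localConj U V G ∈ filterCone ρ := by
  induction hG using AddSubmonoid.closure_induction with
  | mem G h =>
    obtain ⟨n, M, K, rfl⟩ := h
    exact AddSubmonoid.subset_closure ⟨n, _, _, localConj_localConj M K U V _⟩
  | zero => simp
  | add x y _ _ hx hy =>
    rw [map_add]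
    exact add_mem hx hy

/-- Filters on `n` and on `k` copies combine to a filter on `n + k` copies: both parties project
their two qubits on the span of `|00⟩` and `|11⟩`. -/
theorem hadamard_mem_filterCone {G H : Matrix (Fin 2 × Fin 2) (Fin 2 × Fin 2) ℂ}
    (hG : G ∈ filterCone ρ) (hH : H ∈ filterCone ρ) : G ⊙ H ∈ filterCone ρ := by
  classical
  induction hG, hH using AddSubmonoid.closure_induction₂ with
  | mem G H hG hH =>
    obtain ⟨n, M, K, rfl⟩ := hG
    obtain ⟨k, M', K', rfl⟩ := hH
    let e : Fin 2 → Fin 2 × Fin 2 := fun i => (i, i)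
    refine AddSubmonoid.subset_closure ⟨n + k,
      (1 : Matrix (Fin 2 × Fin 2) (Fin 2 × Fin 2) ℂ).submatrix e id * (M ⊗ₖ M') *
        (1 : Matrix (Fin (n + k) → a) _ ℂ).submatrix (Fin.appendEquiv n k) id,
      (1 : Matrix (Fin 2 × Fin 2) (Fin 2 × Fin 2) ℂ).submatrix e id * (K ⊗ₖ K') *
        (1 : Matrix (Fin (n + k) → b) _ ℂ).submatrix (Fin.appendEquiv n k) id, ?_⟩
    rw [← localConj_localConj, ← localConj_localConj,
      localConj_submatrix_one (Fin.appendEquiv n k) (Fin.appendEquiv n k), tensorPower_add,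
      localConj_bipartiteTensor, localConj_submatrix_one]
    rfl
  | zero_left => simp
  | zero_right => simp
  | add_left x y z _ _ _ hx hy =>
    rw [Matrix.add_hadamard]
    exact add_mem hx hy
  | add_right x y z _ _ _ hx hy =>
    rw [Matrix.hadamard_add]
    exact add_mem hx hy

theorem bellDiag_hadamard (α β γ δ α' β' γ' δ' : ℝ) :
    bellDiag α β γ δ ⊙ bellDiag α' β' γ' δ' = bellDiag (α * α') (β * β') (γ * γ') (δ * δ') := by
  ext p q
  simp only [bellDiag, Matrix.hadamard_apply, Matrix.of_apply]
  split_ifs <;> simp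

theorem bellDiag_pow_mem_filterCone {α β γ δ : ℝ} (h : bellDiag α β γ δ ∈ filterCone ρ) (n : ℕ) :
    bellDiag (α ^ (n + 1)) (β ^ (n + 1)) (γ ^ (n + 1)) (δ ^ (n + 1)) ∈ filterCone ρ := by
  induction n with
  | zero => simpa using h
  | succ n ih =>
    simp only [pow_succ _ (n + 1)]
    rw [← bellDiag_hadamard]
    exact hadamard_mem_filterCone ih h

theorem localConj_two_apply (U V : Matrix (Fin 2) (Fin 2) ℂ)
    (G : Matrix (Fin 2 × Fin 2) (Fin 2 × Fin 2) ℂ) (i j k l : Fin 2) :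
    localConj U V G (i, j) (k, l) = ∑ w : Fin 2, ∑ w' : Fin 2, ∑ z : Fin 2, ∑ z' : Fin 2,
      U i z * V j z' * G (z, z') (w, w') * (star (U k w) * star (V l w')) := by
  simp only [localConj_apply, Fintype.sum_prod_type]

/-- Exchanging bit and phase errors by a Hadamard transform of both qubits. -/
theorem localConj_hadamardGate_bellDiag (α β γ : ℝ) :
    localConj !![1, 1; 1, -1] !![1, 1; 1, -1] (bellDiag α β γ 0) =
      bellDiag (2 * (α + β + γ)) (2 * (α + β - γ)) (2 * (α - β + γ)) (2 * (α - β - γ)) := by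
  ext ⟨i, j⟩ ⟨k, l⟩
  rw [localConj_two_apply]
  fin_cases i <;> fin_cases j <;> fin_cases k <;> fin_cases l <;>
    simp [bellDiag, Fin.sum_univ_two] <;> ring

theorem localConj_diagonal (u v : Fin 2 → ℂ) (G : Matrix (Fin 2 × Fin 2) (Fin 2 × Fin 2) ℂ)
    (p q : Fin 2 × Fin 2) : localConj (Matrix.diagonal u) (Matrix.diagonal v) G p q =
      u p.1 * v p.2 * G p q * (star (u q.1) * star (v q.2)) := by
  simp [localConj_def, Matrix.diagonal_kronecker_diagonal, Matrix.diagonal_conjTranspose,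
    Matrix.mul_diagonal, Matrix.diagonal_mul]

/-- Averaging over local unitaries turns a Hermitian operator into a Bell-diagonal one. The
sum runs over eight unitaries and is not divided by their number. -/
theorem twirl_mem_filterCone {G : Matrix (Fin 2 × Fin 2) (Fin 2 × Fin 2) ℂ}
    (hG : G ∈ filterCone ρ) (hH : G.IsHermitian) :
    bellDiag (4 * ((G (0, 0) (0, 0)).re + (G (1, 1) (1, 1)).re)) (8 * (G (0, 0) (1, 1)).re)
      (4 * ((G (0, 1) (0, 1)).re + (G (1, 0) (1, 0)).re)) 0 ∈ filterCone ρ := by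
  have h : ∀ p q, G q p = star (G p q) := fun p q => (hH.apply q p).symm
  have hd : ∀ p, ((G p p).re : ℂ) = G p p := fun p => Complex.conj_eq_iff_re.mp (hH.apply p p)
  let T : (Matrix (Fin 2) (Fin 2) ℂ) → (Matrix (Fin 2) (Fin 2) ℂ) →
      Matrix (Fin 2 × Fin 2) (Fin 2 × Fin 2) ℂ → Matrix (Fin 2 × Fin 2) (Fin 2 × Fin 2) ℂ :=
    fun U V G => G + localConj U V G
  have hT : ∀ U V {G}, G ∈ filterCone ρ → T U V G ∈ filterCone ρ := fun U V G hG =>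
    add_mem hG (localConj_mem_filterCone U V hG)
  -- The two phase gates remove the entries off the two diagonals and the entries between
  -- `|01⟩` and `|10⟩`; the bit flip equalises what remains.
  have hmem := hT ((1 : Matrix (Fin 2) (Fin 2) ℂ).submatrix Fin.rev id)
    ((1 : Matrix (Fin 2) (Fin 2) ℂ).submatrix Fin.rev id)
    (hT (Matrix.diagonal ![1, Complex.I]) (Matrix.diagonal ![1, -Complex.I])
      (hT (Matrix.diagonal ![1, -1]) (Matrix.diagonal ![1, -1]) hG))
  convert hmem using 1
  have h1 : G (1, 1) (0, 0) = star (G (0, 0) (1, 1)) := h _ _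
  have h2 : (8 : ℂ) * ((G (0, 0) (1, 1)).re : ℂ) = 4 * (G (0, 0) (1, 1) + G (1, 1) (0, 0)) := by
    rw [h1, Complex.star_def, Complex.add_conj]
    push_cast
    ring
  ext ⟨i, j⟩ ⟨k, l⟩
  simp only [T, Matrix.add_apply, localConj_submatrix_one, Matrix.submatrix_apply,
    localConj_diagonal]
  fin_cases i <;> fin_cases j <;> fin_cases k <;> fin_cases l <;>
    simp [bellDiag, hd, h2] <;> ring_nf <;> simp <;> ring

theorem maxEnt_trace_bellDiag (α β γ δ : ℝ) :
    (maxEnt (Fin 2) * bellDiag α β γ δ).trace.re = α + β := by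
  have h : (Real.sqrt 2 : ℂ)⁻¹ * (Real.sqrt 2 : ℂ)⁻¹ = 1 / 2 := by
    rw [← mul_inv, ← Complex.ofReal_mul, Real.mul_self_sqrt (by norm_num)]
    norm_num
  have h2 : maxEnt (Fin 2) = bellDiag (1 / 2) (1 / 2) 0 0 := by
    ext ⟨i, j⟩ ⟨k, l⟩
    fin_cases i <;> fin_cases j <;> fin_cases k <;> fin_cases l <;>
      simp [maxEnt, maxEntVec, bellDiag, Matrix.vecMulVec_apply, h]
  rw [h2]
  simp [Matrix.trace, Matrix.mul_apply, Fintype.sum_prod_type, bellDiag, Fin.sum_univ_two]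
  ring

theorem trace_bellDiag (α β γ δ : ℝ) : (bellDiag α β γ δ).trace.re = 2 * α + 2 * γ := by
  simp [Matrix.trace, Fintype.sum_prod_type, bellDiag, Fin.sum_univ_two]
  ring

/-- The fidelity of the error-detection protocol tends to one. The entrywise power `n + 1`
suppresses the bit errors `γ`; the power `m + 1` in the conjugate basis suppresses the phase
errors. The second power is of the order of `(α / β) ^ n`, which is too small for the remaining
bit errors, of the order of `(γ / α) ^ n`, to accumulate. -/
theorem exists_errorDetection_parameters {α β γ ε : ℝ} (hγ : 0 ≤ γ) (hβ : γ < β) (hα : β ≤ α)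
    (hε : 0 < ε) : ∃ n m : ℕ,
      (1 - ε) * (2 * (2 * (α ^ (n + 1) + β ^ (n + 1) + γ ^ (n + 1))) ^ (m + 1) +
        2 * (2 * (α ^ (n + 1) - β ^ (n + 1) + γ ^ (n + 1))) ^ (m + 1)) <
      (2 * (α ^ (n + 1) + β ^ (n + 1) + γ ^ (n + 1))) ^ (m + 1) +
        (2 * (α ^ (n + 1) + β ^ (n + 1) - γ ^ (n + 1))) ^ (m + 1) := by
  have hβ0 : 0 < β := hγ.trans_lt hβ
  set t : ℝ := 6 / ε with ht
  have ht0 : 0 < t := by positivity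
  obtain ⟨n, hn⟩ : ∃ n : ℕ, (γ / β) ^ n < ε / 4 / (2 * (t + 1)) :=
    exists_pow_lt_of_lt_one (by positivity) ((div_lt_one hβ0).mpr hβ)
  have hn' : (γ / β) ^ (n + 1) < ε / 4 / (2 * (t + 1)) :=
    (pow_le_pow_of_le_one (by positivity) ((div_lt_one hβ0).mpr hβ).le n.le_succ).trans_lt hn
  set A := α ^ (n + 1) with hA
  set B := β ^ (n + 1) with hB
  set C := γ ^ (n + 1) with hC
  have hA0 : 0 < A := pow_pos (hβ0.trans_le hα) _
  have hB0 : 0 < B := pow_pos hβ0 _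
  have hC0 : 0 ≤ C := pow_nonneg hγ _
  have hBA : B ≤ A := pow_le_pow_left₀ hβ0.le hα _
  have hCB : C ≤ B := pow_le_pow_left₀ hγ hβ.le _
  have hCB' : 2 * (t + 1) * (C / B) < ε / 4 := by
    rw [div_pow, lt_div_iff₀ (by positivity)] at hn'
    linarith
  have hm0 : 0 < ⌈t * A / B⌉₊ := Nat.ceil_pos.mpr (by positivity)
  obtain ⟨m, hm⟩ := Nat.exists_eq_succ_of_ne_zero hm0.ne'
  have hm1 : t * A / B ≤ ((m + 1 : ℕ) : ℝ) := (Nat.le_ceil _).trans_eq (congrArg _ hm)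
  have hm2 : ((m + 1 : ℕ) : ℝ) < t * A / B + 1 := by
    have := Nat.ceil_lt_add_one (a := t * A / B) (by positivity)
    rwa [hm] at this
  refine ⟨n, m, ?_⟩
  set X := A + B + C with hX
  have hX0 : 0 < X := by positivity
  have hy : 1 - ε / 4 < ((A + B - C) / X) ^ (m + 1) := by
    have h1 : (A + B - C) / X = 1 + -(2 * C / X) := by
      rw [hX]; field_simp; ring
    have h2 : C / X ≤ C / A := div_le_div_of_nonneg_left hC0 hA0 (by linarith)
    have h3 : C / X ≤ 1 := (div_le_one hX0).mpr (by linarith)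
    have h4 := one_add_mul_le_pow (a := -(2 * C / X)) (by rw [mul_div_assoc]; linarith) (m + 1)
    rw [h1]
    refine lt_of_lt_of_le ?_ h4
    have h5 : ((m + 1 : ℕ) : ℝ) * (C / X) ≤ (t + 1) * (C / B) := by
      calc ((m + 1 : ℕ) : ℝ) * (C / X) ≤ (t * A / B + A / B) * (C / A) := by
            have : 1 ≤ A / B := (one_le_div hB0).mpr hBA
            gcongr
            linarith
        _ = (t + 1) * (C / B) := by field_simp
    rw [mul_div_assoc]
    linarith
  have hz : ((A - B + C) / X) ^ (m + 1) ≤ ε / 4 := by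
    have h1 : (A - B + C) / X = 1 - 2 * B / X := by
      rw [hX]; field_simp; ring
    have h0 : 0 ≤ (A - B + C) / X := div_nonneg (by linarith) hX0.le
    have h2 : ((A - B + C) / X) ^ (m + 1) * (1 + ((m + 1 : ℕ) : ℝ) * (2 * B / X)) ≤ 1 := by
      have h3 := one_add_mul_le_pow (a := 2 * B / X)
        (by have : 0 ≤ 2 * B / X := by positivity
            linarith) (m + 1)
      refine (mul_le_mul_of_nonneg_left h3 (pow_nonneg h0 _)).trans ?_
      rw [← mul_pow, h1]
      refine pow_le_one₀ ?_ ?_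
      · rw [← h1]; positivity
      · nlinarith [sq_nonneg (2 * B / X)]
    have h4 : 4 / ε ≤ ((m + 1 : ℕ) : ℝ) * (2 * B / X) := by
      calc 4 / ε = t * A / B * (2 * B / (3 * A)) := by rw [ht]; field_simp; norm_num
        _ ≤ _ := by gcongr; linarith
    have h5 : 0 ≤ ((A - B + C) / X) ^ (m + 1) := pow_nonneg h0 _
    have h6 : ((A - B + C) / X) ^ (m + 1) * (4 / ε) ≤ 1 := by nlinarith
    rw [mul_div_assoc', div_le_one hε] at h6
    linarith
  have hz0 : 0 ≤ ((A - B + C) / X) ^ (m + 1) := pow_nonneg (div_nonneg (by linarith) hX0.le) _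
  have hfin : (1 - ε) * (2 + 2 * ((A - B + C) / X) ^ (m + 1)) <
      1 + ((A + B - C) / X) ^ (m + 1) := by
    have hy0 : 0 ≤ ((A + B - C) / X) ^ (m + 1) := pow_nonneg (div_nonneg (by linarith) hX0.le) _
    rcases le_total 1 ε with h | h <;> nlinarith
  have hP : 0 < (2 * X) ^ (m + 1) := by positivity
  have e1 : ∀ W : ℝ, (2 * W) ^ (m + 1) = (2 * X) ^ (m + 1) * (W / X) ^ (m + 1) := fun W => by
    rw [← mul_pow]
    congr 1
    field_simp
  rw [e1 (A - B + C), e1 (A + B - C)]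
  nlinarith

/-- A two-qubit filter of positive excess `2 Re ω₀₀,₁₁ - ω₀₁,₀₁ - ω₁₀,₁₀`, that is, of fidelity
larger than one half, makes `ρ` distillable. -/
theorem isDistillable_of_excess (hρ : IsState ρ) (M : Matrix (Fin 2) a ℂ)
    (K : Matrix (Fin 2) b ℂ)
    (h : (localConj M K ρ (0, 1) (0, 1)).re + (localConj M K ρ (1, 0) (1, 0)).re <
      2 * (localConj M K ρ (0, 0) (1, 1)).re) : IsDistillable ρ := by
  classical
  refine isDistillable_of_filter hρ fun ε hε => ?_
  set G := localConj M K ρ with hG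
  have hpos : G.PosSemidef := localConj_posSemidef M K hρ.posSemidef
  have hmem : G ∈ filterCone ρ := by
    refine AddSubmonoid.subset_closure ⟨1,
      M * (1 : Matrix (Fin 1 → a) _ ℂ).submatrix (Equiv.funUnique (Fin 1) a).symm id,
      K * (1 : Matrix (Fin 1 → b) _ ℂ).submatrix (Equiv.funUnique (Fin 1) b).symm id, ?_⟩
    rw [← localConj_localConj, localConj_submatrix_one, tensorPower_one]
  have hdiag : ∀ p, 0 ≤ (G p p).re := fun p => (Complex.le_def.mp hpos.diag_nonneg).1
  -- Positivity against the vector `|00⟩ - |11⟩`.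
  have hα : 2 * (G (0, 0) (1, 1)).re ≤ (G (0, 0) (0, 0)).re + (G (1, 1) (1, 1)).re := by
    have h1 := (Complex.le_def.mp (hpos.dotProduct_mulVec_nonneg
      (fun p => if p = (0, 0) then 1 else if p = (1, 1) then -1 else 0))).1
    have h2 : (G (1, 1) (0, 0)).re = (G (0, 0) (1, 1)).re := by
      rw [← hpos.1.apply (1, 1) (0, 0)]; simp
    simp [dotProduct, Matrix.mulVec, Fintype.sum_prod_type, Fin.sum_univ_two] at h1
    linarith
  obtain ⟨n, m, hnm⟩ := exists_errorDetection_parameters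
    (α := 4 * ((G (0, 0) (0, 0)).re + (G (1, 1) (1, 1)).re)) (β := 8 * (G (0, 0) (1, 1)).re)
    (γ := 4 * ((G (0, 1) (0, 1)).re + (G (1, 0) (1, 0)).re))
    (by linarith [hdiag (0, 1), hdiag (1, 0)]) (by linarith) (by linarith) hε
  have hfinal := bellDiag_pow_mem_filterCone (n := n) (twirl_mem_filterCone hmem hpos.1)
  rw [zero_pow n.succ_ne_zero] at hfinal
  have hfinal := localConj_mem_filterCone !![1, 1; 1, -1] !![1, 1; 1, -1] hfinal
  rw [localConj_hadamardGate_bellDiag] at hfinal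
  have hfinal := bellDiag_pow_mem_filterCone (n := m) hfinal
  -- The comparison of fidelity and probability is linear, so some summand satisfies it.
  by_contra! hcon
  have hle : ∀ F ∈ filterCone ρ,
      (maxEnt (Fin 2) * F).trace.re ≤ (1 - ε) * F.trace.re := by
    intro F hF
    induction hF using AddSubmonoid.closure_induction with
    | mem F h =>
      obtain ⟨n, M, K, rfl⟩ := h
      exact hcon n M K
    | zero => simp
    | add x y _ _ hx hy =>
      rw [Matrix.mul_add, Matrix.trace_add, Matrix.trace_add, Complex.add_re, Complex.add_re]
      linarith
  have := hle _ hfinal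
  rw [maxEnt_trace_bellDiag, trace_bellDiag] at this
  linarith

end

/-! ### The reduction criterion -/

section

variable {a b c r : Type} [Fintype a] [Fintype b]

theorem localConj_submatrix {d d' e e' : Type} (M : Matrix d a ℂ) (K : Matrix e b ℂ) (f : d' → d)
    (g : e' → e) (X : Matrix (a × b) (a × b) ℂ) :
    localConj (M.submatrix f id) (K.submatrix g id) X =
      (localConj M K X).submatrix (Prod.map f g) (Prod.map f g) := rfl

variable [Fintype c] [Fintype r]

/-- The overlap of `X` with the unnormalised maximally entangled vector `∑ i, |i⟩|i⟩`. -/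
def maxEntOverlap (X : Matrix (c × c) (c × c) ℂ) : ℝ :=
  (∑ i, ∑ j, X (i, i) (j, j)).re

theorem maxEntOverlap_add (X Y : Matrix (c × c) (c × c) ℂ) :
    maxEntOverlap (X + Y) = maxEntOverlap X + maxEntOverlap Y := by
  simp [maxEntOverlap, Finset.sum_add_distrib]

theorem maxEntOverlap_sum {ι : Type} [Fintype ι] (X : ι → Matrix (c × c) (c × c) ℂ) :
    maxEntOverlap (∑ k, X k) = ∑ k, maxEntOverlap (X k) := by
  exact map_sum (AddMonoidHom.mk' maxEntOverlap maxEntOverlap_add) X Finset.univ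

theorem maxEntOverlap_nonneg {X : Matrix (c × c) (c × c) ℂ} (hX : X.PosSemidef) :
    0 ≤ maxEntOverlap X := by
  classical
  have h := (Complex.le_def.mp (hX.dotProduct_mulVec_nonneg
    (fun p => if p.1 = p.2 then 1 else 0))).1
  simpa [maxEntOverlap, dotProduct, Matrix.mulVec, Fintype.sum_prod_type, apply_ite] using h

theorem trace_traceLeft (X : Matrix (a × b) (a × b) ℂ) : (traceLeft X).trace = X.trace := by
  simp only [Matrix.trace, Matrix.diag, traceLeft, Matrix.of_apply, Fintype.sum_prod_type]
  exact Finset.sum_comm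

/-- A state that is not distillable has no two-dimensional filter of positive excess. Summing over
all pairs of basis vectors bounds the overlap with a maximally entangled state in any
dimension. -/
theorem maxEntOverlap_localConj_le {ρ : Matrix (a × b) (a × b) ℂ} (hρ : IsState ρ)
    (h : ¬ IsDistillable ρ) (M : Matrix c a ℂ) (K : Matrix c b ℂ) :
    maxEntOverlap (localConj M K ρ) ≤ (localConj M K ρ).trace.re := by
  have hpair : ∀ i j, 2 * (localConj M K ρ (i, i) (j, j)).re ≤
      (localConj M K ρ (i, j) (i, j)).re + (localConj M K ρ (j, i) (j, i)).re := fun i j => by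
    by_contra! hlt
    refine h (isDistillable_of_excess hρ (M.submatrix ![i, j] id) (K.submatrix ![i, j] id) ?_)
    rw [localConj_submatrix]
    exact hlt
  have hsum := Finset.sum_le_sum fun i (_ : i ∈ (Finset.univ : Finset c)) =>
    Finset.sum_le_sum fun j (_ : j ∈ (Finset.univ : Finset c)) => hpair i j
  simp only [Finset.sum_add_distrib, ← Finset.mul_sum] at hsum
  rw [Finset.sum_comm (f := fun i j => (localConj M K ρ (j, i) (j, i)).re)] at hsum
  simp only [maxEntOverlap, Complex.re_sum, Matrix.trace, Matrix.diag, Fintype.sum_prod_type]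
  linarith

/-- The reduction criterion for the states that Alice can prepare by filtering an undistillable
state. -/
theorem posSemidef_one_kronecker_traceLeft_sub [DecidableEq b] [DecidableEq c]
    {ρ : Matrix (a × b) (a × b) ℂ} (hρ : IsState ρ)
    (h : ¬ IsDistillable ρ) (M : Matrix c a ℂ) :
    ((1 : Matrix c c ℂ) ⊗ₖ traceLeft (localConj M (1 : Matrix b b ℂ) ρ) -
      localConj M (1 : Matrix b b ℂ) ρ).PosSemidef := by
  set σ := localConj M (1 : Matrix b b ℂ) ρ with hσ
  have hpos : σ.PosSemidef := localConj_posSemidef _ _ hρ.posSemidef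
  have hherm : ((1 : Matrix c c ℂ) ⊗ₖ traceLeft σ - σ).IsHermitian := by
    refine Matrix.IsHermitian.sub ?_ hpos.1
    have h1 : (traceLeft σ).IsHermitian := by
      ext s t
      simp only [Matrix.conjTranspose_apply, traceLeft, Matrix.of_apply, star_sum]
      exact Finset.sum_congr rfl fun i _ => hpos.1.apply _ _
    rw [Matrix.IsHermitian, Matrix.conjTranspose_kronecker, h1, Matrix.conjTranspose_one]
  refine Matrix.PosSemidef.of_dotProduct_mulVec_nonneg hherm fun ψ => ?_
  have hre : 0 ≤ (star ψ ⬝ᵥ ((1 : Matrix c c ℂ) ⊗ₖ traceLeft σ - σ) *ᵥ ψ).re := by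
    -- The vector `ψ` is the image of the maximally entangled vector under a filter of Bob.
    let K : Matrix c b ℂ := Matrix.of fun t u => star (ψ (t, u))
    have h1 := maxEntOverlap_localConj_le hρ h M K
    have h2 : localConj M K ρ = localConj (1 : Matrix c c ℂ) K σ := by
      rw [hσ, localConj_localConj, Matrix.one_mul, Matrix.mul_one]
    have h3 : star ψ ⬝ᵥ σ *ᵥ ψ = ∑ i, ∑ j, localConj (1 : Matrix c c ℂ) K σ (i, i) (j, j) := by
      simp [localConj_apply, dotProduct, Matrix.mulVec, Fintype.sum_prod_type, Matrix.one_apply, K]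
      simp only [Finset.mul_sum]
      refine Finset.sum_congr rfl fun x _ => Finset.sum_comm.trans ?_
      refine Finset.sum_congr rfl fun x' _ => Finset.sum_comm.trans ?_
      exact Finset.sum_congr rfl fun _ _ => Finset.sum_congr rfl fun _ _ => (mul_assoc _ _ _).symm
    have h4 : star ψ ⬝ᵥ ((1 : Matrix c c ℂ) ⊗ₖ traceLeft σ) *ᵥ ψ =
        (localConj (1 : Matrix c c ℂ) K σ).trace := by
      simp [localConj_apply, dotProduct, Matrix.mulVec, Fintype.sum_prod_type, Matrix.one_apply, K,
        Matrix.trace, traceLeft]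
      simp only [Finset.mul_sum, Finset.sum_mul]
      refine Eq.trans (Finset.sum_congr rfl fun x _ => ?_) Finset.sum_comm
      refine Finset.sum_comm.trans (Eq.trans (Finset.sum_congr rfl fun u _ => ?_) Finset.sum_comm)
      refine Finset.sum_comm.trans ?_
      exact Finset.sum_congr rfl fun _ _ => Finset.sum_congr rfl fun _ _ => (mul_assoc _ _ _).symm
    rw [h2, maxEntOverlap, ← h3, ← h4] at h1
    rw [Matrix.sub_mulVec, dotProduct_sub, Complex.sub_re]
    linarith
  refine Complex.le_def.mpr ⟨hre, ?_⟩
  exact (hherm.im_star_dotProduct_mulVec_self ψ).symm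

/-! ### The fidelity of a teleportation protocol -/

theorem IsCP.posSemidef_idTensor {E : SuperOp a b} (hE : IsCP E) {X : Matrix (r × a) (r × a) ℂ}
    (hX : X.PosSemidef) : (idTensor r E X).PosSemidef := by
  let e := Fintype.equivFin r
  convert (hE _ _ (hX.submatrix (Prod.map e.symm id))).submatrix (Prod.map e id) using 1
  ext p q
  simp [idTensor]

/-- The unnormalised state of `C''B` after Alice has obtained the outcome with POVM element `T` on
`C'A`, multiplied by `|C|`, when `C'` is one half of the maximally entangled state of `C''C'`. -/
def aliceOutput (T : Matrix (c × a) (c × a) ℂ) (ρ : Matrix (a × b) (a × b) ℂ) :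
    Matrix (c × b) (c × b) ℂ :=
  Matrix.of fun x y => ∑ p, ∑ q, T (y.1, p) (x.1, q) * ρ (q, x.2) (p, y.2)

theorem aliceOutput_eq_sum {d : Type} [DecidableEq b] (Q : Matrix r (d × a) ℂ)
    (ρ : Matrix (a × b) (a × b) ℂ) :
    aliceOutput (Qᴴ * Q) ρ =
      ∑ k, localConj (Matrix.of fun t q => Q k (t, q)) (1 : Matrix b b ℂ) ρ := by
  ext x y
  simp [aliceOutput, Matrix.sum_apply, localConj_apply, Matrix.mul_apply, Fintype.sum_prod_type,
    Matrix.one_apply, Finset.sum_mul]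
  refine Eq.trans (Finset.sum_congr rfl fun p _ => ?_) Finset.sum_comm
  refine Finset.sum_comm.trans ?_
  exact Finset.sum_congr rfl fun _ _ => Finset.sum_congr rfl fun _ _ => by ring

theorem sum_trace_aliceOutput [DecidableEq a] [DecidableEq c] {ι : Type} [Fintype ι]
    {T : ι → Matrix (c × a) (c × a) ℂ} (hT : ∑ i, T i = 1) (ρ : Matrix (a × b) (a × b) ℂ) :
    ∑ i, (aliceOutput (T i) ρ).trace = Fintype.card c * ρ.trace := by
  have h : ∀ x y, ∑ i, T i x y = (1 : Matrix (c × a) (c × a) ℂ) x y := fun x y => by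
    rw [← hT, Matrix.sum_apply]
  simp only [Matrix.trace, Matrix.diag, aliceOutput, Matrix.of_apply]
  rw [Finset.sum_comm]
  have h2 : ∀ x : c × b, ∑ i, ∑ p, ∑ q, T i (x.1, p) (x.1, q) * ρ (q, x.2) (p, x.2) =
      ∑ p, ρ (p, x.2) (p, x.2) := fun x => by
    rw [Finset.sum_comm]
    refine Finset.sum_congr rfl fun p _ => ?_
    rw [Finset.sum_comm]
    simp [← Finset.sum_mul, h, Matrix.one_apply]
  simp only [h2, Fintype.sum_prod_type]
  rw [Finset.sum_const, Finset.card_univ, nsmul_eq_mul]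
  congr 1
  exact Finset.sum_comm

/-- The reduction criterion bounds what Bob can achieve after any outcome of Alice. -/
theorem maxEntOverlap_idTensor_aliceOutput_le {ρ : Matrix (a × b) (a × b) ℂ} (hρ : IsState ρ)
    (h : ¬ IsDistillable ρ) {T : Matrix (c × a) (c × a) ℂ} (hT : T.PosSemidef)
    {D : SuperOp b c} (hD : IsChannel D) :
    maxEntOverlap (idTensor c D (aliceOutput T ρ)) ≤ (aliceOutput T ρ).trace.re := by
  classical
  obtain ⟨Q, rfl⟩ := exists_eq_conjTranspose_mul_self hT
  rw [aliceOutput_eq_sum, map_sum, maxEntOverlap_sum, Matrix.trace_sum, Complex.re_sum]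
  refine Finset.sum_le_sum fun k _ => ?_
  set σ := localConj (Matrix.of fun t q => Q k (t, q)) (1 : Matrix b b ℂ) ρ with hσ
  have h1 := maxEntOverlap_nonneg (hD.cp.posSemidef_idTensor
    (posSemidef_one_kronecker_traceLeft_sub hρ h (Matrix.of fun t q => Q k (t, q))))
  have h2 : maxEntOverlap (idTensor c D ((1 : Matrix c c ℂ) ⊗ₖ traceLeft σ)) = σ.trace.re := by
    rw [idTensor_kronecker, ← trace_traceLeft, ← hD.trace_eq]
    simp [maxEntOverlap, Matrix.trace, Matrix.one_apply]
  have h3 : (1 : Matrix c c ℂ) ⊗ₖ traceLeft σ =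
      ((1 : Matrix c c ℂ) ⊗ₖ traceLeft σ - σ) + σ := by abel
  rw [← h2, h3, map_add, maxEntOverlap_add]
  linarith

theorem TeleportationProtocol.channel_single [DecidableEq a] [DecidableEq b] [DecidableEq c]
    {N : ℕ} (P : TeleportationProtocol a b c N) (t s : c) :
    P.channel (Matrix.single t s 1) t s =
      ∑ i, idTensor c (P.decoder i) (aliceOutput (P.povm i) P.ρ) (t, t) (s, s) := by
  change (∑ i, traceLeft (idTensor (c × a) (P.decoder i)
    ((P.povm i ⊗ₖ (1 : Matrix b b ℂ)) * ((Matrix.single t s 1) ⊗ₖ P.ρ).submatrix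
      (Equiv.prodAssoc c a b) (Equiv.prodAssoc c a b)))) t s = _
  rw [Matrix.sum_apply]
  refine Finset.sum_congr rfl fun i _ => ?_
  change ∑ p, P.decoder i _ t s = P.decoder i _ t s
  rw [← Matrix.sum_apply, ← map_sum]
  refine congrArg (fun Y => P.decoder i Y t s) ?_
  ext u v
  simp only [Matrix.sum_apply, Matrix.of_apply, Matrix.mul_apply, aliceOutput,
    Fintype.sum_prod_type, kroneckerMap_apply, Matrix.submatrix_apply, Equiv.prodAssoc_apply]
  simp [Matrix.one_apply, Matrix.single_apply, ite_and]

theorem TeleportationProtocol.fidelity_eq [DecidableEq a] [DecidableEq b] [DecidableEq c]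
    {N : ℕ} (P : TeleportationProtocol a b c N) :
    P.fidelity = (1 / (Fintype.card c : ℝ)) ^ 2 *
      ∑ i, maxEntOverlap (idTensor c (P.decoder i) (aliceOutput (P.povm i) P.ρ)) := by
  have hent : ∀ p q : c × c, maxEnt c p q =
      if p.1 = p.2 then (if q.1 = q.2 then ((1 / (Fintype.card c : ℝ) : ℝ) : ℂ) else 0)
        else 0 := by
    intro p q
    have h : (Real.sqrt (Fintype.card c) : ℂ)⁻¹ * (Real.sqrt (Fintype.card c) : ℂ)⁻¹ =
        ((Fintype.card c : ℝ) : ℂ)⁻¹ := by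
      rw [← mul_inv, ← Complex.ofReal_mul, Real.mul_self_sqrt (Nat.cast_nonneg _)]
    simp only [maxEnt, maxEntVec, Matrix.vecMulVec_apply, Pi.star_apply]
    split_ifs <;> simp_all
  have hblock : ∀ t s : c, (Matrix.of fun u v => maxEnt c (t, u) (s, v)) =
      ((1 / (Fintype.card c : ℝ) : ℝ) : ℂ) • Matrix.single t s (1 : ℂ) := by
    intro t s
    ext u v
    simp only [Matrix.of_apply, hent, Matrix.smul_apply, Matrix.single_apply, smul_eq_mul]
    split_ifs <;> simp_all
  have hval : ∀ t s : c, idTensor c P.channel (maxEnt c) (t, t) (s, s) =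
      ((1 / (Fintype.card c : ℝ) : ℝ) : ℂ) *
        ∑ i, idTensor c (P.decoder i) (aliceOutput (P.povm i) P.ρ) (t, t) (s, s) := by
    intro t s
    change P.channel (Matrix.of fun u v => maxEnt c (t, u) (s, v)) t s = _
    rw [hblock, map_smul, Matrix.smul_apply, P.channel_single, smul_eq_mul]
  have htr : (maxEnt c * idTensor c P.channel (maxEnt c)).trace =
      ((1 / (Fintype.card c : ℝ) : ℝ) : ℂ) *
        ∑ t, ∑ s, idTensor c P.channel (maxEnt c) (t, t) (s, s) := by
    simp only [Matrix.trace, Matrix.diag, Matrix.mul_apply, hent, Fintype.sum_prod_type]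
    simp [Finset.mul_sum]
    exact Finset.sum_comm
  rw [TeleportationProtocol.fidelity, entFidelity, htr]
  simp only [hval, ← Finset.mul_sum]
  rw [← mul_assoc, ← Complex.ofReal_mul, Complex.re_ofReal_mul, sq, ← maxEntOverlap_sum]
  simp only [maxEntOverlap, Matrix.sum_apply]

end

end

end QTeleport

theorem mainTheorem7 {a b c : Type} [Fintype a] [Fintype b] [Fintype c]
    [DecidableEq a] [DecidableEq b] [DecidableEq c] {N : ℕ}
    (P : QTeleport.TeleportationProtocol a b c N)
    (hP : QTeleport.IsBoundEntangled P.ρ) :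
    P.fidelity ≤ 1 / (Fintype.card c : ℝ) := by
  have h1 : ∑ i, QTeleport.maxEntOverlap (QTeleport.idTensor c (P.decoder i)
      (QTeleport.aliceOutput (P.povm i) P.ρ)) ≤ Fintype.card c := by
    calc _ ≤ ∑ i, (QTeleport.aliceOutput (P.povm i) P.ρ).trace.re :=
          Finset.sum_le_sum fun i _ => QTeleport.maxEntOverlap_idTensor_aliceOutput_le P.isState
            hP.undistillable (P.isPOVM.posSemidef i) (P.isChannel i)
      _ = Fintype.card c := by
          rw [← Complex.re_sum, QTeleport.sum_trace_aliceOutput P.isPOVM.sum_eq_one,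
            P.isState.trace_eq_one]
          simp
  rw [P.fidelity_eq]
  refine (mul_le_mul_of_nonneg_left h1 (by positivity)).trans_eq ?_
  -- For `|C| = 0` both sides vanish.
  rcases eq_or_ne (Fintype.card c : ℝ) 0 with h | h
  · simp [h]
  · field_simp
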